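/- Let $1\le p<\infty$, let $X$ be a pointed metric space with base point $0$, and let $E,F$ be real Banach spaces. A map $T:X\times E\to F$ is Lip-linear if $T(x,\cdot)$ is linear for every $x\in X$ and there is $C>0$ with $\|T(x,e)-T(y,e)\|\le C\,d(x,y)\|e\|$ for all $x,y\in X$, $e\in E$; the infimum of such $C$ is $LipL(T)$. $LipL_0(X\times E;F)$ is the space of Lip-linear maps with $T(0,e)=0$ for all $e\in E$, and $B_{LipL_0(X\times E)}=\{\varphi\in LipL_0(X\times E;\mathbb R): LipL(\varphi)\le 1\}$, with the topology of pointwise convergence on $X\times E$. Let $X\boxtimes E$ be the linear span of the functionals $\delta_{(x,y)}\boxtimes e: f\mapsto\langle f(x)-f(y),e\rangle$ on $Lip_0(X;E^*)$, the space of Lipschitz maps $X\to E^*$ vanishing at $0$, with the norm $\pi(u)=\inf\{\sum_i d(x_i,y_i)\|e_i\| : u=\sum_i\delta_{(x_i,y_i)}\boxtimes e_i\}$; let $X\widehat\boxtimes_\pi E$ be its completion. The linearization of $T$ is the bounded linear operator $\widehat T:X\widehat\boxtimes_\pi E\to F$ with $\widehat T(\sum_i\delta_{(x_i,y_i)}\boxtimes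 e_i)=\sum_i (T(x_i,e_i)-T(y_i,e_i))$. $T$ is factorable strongly $p$-summing if there is $C>0$ such that for all $n,m$ and all $x_i^j,y_i^j\in X$, $e_i^j\in E$ ($1\le i\le n$, $1\le j\le m$), $$\Big(\sum_{i=1}^n\Big\|\sum_{j=1}^m \big(T(x_i^j,e_i^j)-T(y_i^j,e_i^j)\big)\Big\|^p\Big)^{1/p}\le C\sup_{\varphi\in B_{LipL_0(X\times E)}}\Big(\sum_{i=1}^n\Big|\sum_{j=1}^m\big(\varphi(x_i^j,e_i^j)-\varphi(y_i^j,e_i^j)\big)\Big|^p\Big)^{1/p}.$$ $\Pi^{LipL}_{F,St,p}(X\times E;F)$ is the space of all such $T\in LipL_0(X\times E;F)$, and $\pi^{LipL}_{F,St,p}(T)$ is the infimum of the admissible $C$. A bounded linear $u:G\to F$ is $p$-summing if there is $C>0$ with $(\sum_i\|u(g_i)\|^p)^{1/p}\le C\sup_{\varphi\in B_{G^*}}(\sum_i|\varphi(g_i)|^p)^{1/p}$ for all finite families $(g_i)$ in $G$; $\Pi_p(G;F)$ is the space of all such $u$, and $\pi_p(u)$ is the infimum of the admissible $C$. Theorem.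 For every Lip-linear $T:X\times E\to F$ the following are equivalent: 1) $T$ is factorable strongly $p$-summing. 2) $\widehat T:X\widehat\boxtimes_\pi E\to F$ is $p$-summing. 3) There are a regular Borel probability measure $\mu$ on $B_{LipL_0(X\times E)}$ and a constant $C>0$ such that for all $m$ and all $x^j,y^j\in X$, $e^j\in E$ ($1\le j\le m$), $$\Big\|\sum_{j=1}^m\big(T(x^j,e^j)-T(y^j,e^j)\big)\Big\|\le C\Big(\int_{B_{LipL_0(X\times E)}}\Big|\sum_{j=1}^m\big(\varphi(x^j,e^j)-\varphi(y^j,e^j)\big)\Big|^p\,d\mu(\varphi)\Big)^{1/p}.$$ Moreover, $T\mapsto\widehat T$ is a linear bijection from $\Pi^{LipL}_{F,St,p}(X\times E;F)$ onto $\Pi_p(X\widehat\boxtimes_\pi E;F)$ with $\pi_p(\widehat T)=\pi^{LipL}_{F,St,p}(T)$; that is, $\Pi^{LipL}_{F,St,p}(X\times E;F)=\Pi_p(X\widehat\boxtimes_\pi E;F)$ isometrically. -/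

import Mathlib

open MeasureTheory

noncomputable section

/-! ### Lip-linear operators -/

/-- The vector space of Lip-linear operators `T : X × E → F`, in curried form: each `T x` is a
linear map `E → F`, and `‖T (x, e) - T (y, e)‖ ≤ C d(x, y) ‖e‖` for some constant `C`. -/
def LipLinear (X E F : Type*) [MetricSpace X] [NormedAddCommGroup E] [NormedSpace ℝ E]
    [NormedAddCommGroup F] [NormedSpace ℝ F] : Submodule ℝ (X → E →ₗ[ℝ] F) where
  carrier := {T | ∃ C : ℝ, 0 < C ∧ ∀ x y e, ‖T x e - T y e‖ ≤ C * dist x y * ‖e‖}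
  zero_mem' := ⟨1, one_pos, fun x y e => by
    simp only [Pi.zero_apply, LinearMap.zero_apply, sub_self, norm_zero]; positivity⟩
  add_mem' := by
    rintro S T ⟨C, hC, hS⟩ ⟨D, hD, hT⟩
    refine ⟨C + D, by positivity, fun x y e => ?_⟩
    have h : (S + T) x e - (S + T) y e = (S x e - S y e) + (T x e - T y e) := by
      simp only [Pi.add_apply, LinearMap.add_apply]; abel
    rw [h]
    refine (norm_add_le _ _).trans ((add_le_add (hS x y e) (hT x y e)).trans (le_of_eq ?_))
    ring
  smul_mem' := by
    rintro c T ⟨C, hC, hT⟩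
    refine ⟨(|c| + 1) * C, by positivity, fun x y e => ?_⟩
    have h : (c • T) x e - (c • T) y e = c • (T x e - T y e) := by
      simp only [Pi.smul_apply, LinearMap.smul_apply, smul_sub]
    rw [h, norm_smul, Real.norm_eq_abs]
    have h1 : 0 ≤ C * dist x y * ‖e‖ := by positivity
    have h2 := mul_le_mul_of_nonneg_left (hT x y e) (abs_nonneg c)
    nlinarith

section

variable {X E F : Type*} [MetricSpace X] [NormedAddCommGroup E] [NormedSpace ℝ E]
  [NormedAddCommGroup F] [NormedSpace ℝ F]

instance : CoeFun (LipLinear X E F) (fun _ => X → E →ₗ[ℝ] F) := ⟨Subtype.val⟩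

/-- The norm `LipL(T)`: the infimum of the constants `C` admissible for `T`. -/
def lipLNorm (T : LipLinear X E F) : ℝ :=
  sInf {C : ℝ | 0 < C ∧ ∀ x y e, ‖T x e - T y e‖ ≤ C * dist x y * ‖e‖}

/-- The space `LipL₀(X × E; F)` of Lip-linear operators with `T (x₀, e) = 0` for all `e`, where
`x₀` is the base point of `X`. -/
def LipLinear₀ (x₀ : X) (E F : Type*) [NormedAddCommGroup E] [NormedSpace ℝ E]
    [NormedAddCommGroup F] [NormedSpace ℝ F] : Submodule ℝ (LipLinear X E F) where
  carrier := {T | ∀ e, T x₀ e = 0}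
  zero_mem' := fun _ => rfl
  add_mem' := by
    intro S T hS hT e
    change S x₀ e + T x₀ e = 0
    rw [hS e, hT e, add_zero]
  smul_mem' := by
    intro c T hT e
    change c • T x₀ e = 0
    rw [hT e, smul_zero]

/-- The closed unit ball of `LipL₀(X × E) = LipL₀(X × E; ℝ)`. -/
def LipLBall (x₀ : X) (E : Type*) [NormedAddCommGroup E] [NormedSpace ℝ E] : Type _ :=
  {φ : LipLinear₀ x₀ E ℝ // lipLNorm (φ : LipLinear X E ℝ) ≤ 1}

instance (x₀ : X) : CoeFun (LipLBall x₀ E) (fun _ => X → E →ₗ[ℝ] ℝ) := ⟨fun φ => φ.1.1.1⟩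

/-- The unit ball carries the topology of pointwise convergence on `X × E`
(the weak-* topology, for which it is a compact Hausdorff space). -/
instance (x₀ : X) : TopologicalSpace (LipLBall x₀ E) :=
  TopologicalSpace.induced (fun (φ : LipLBall x₀ E) (z : X × E) => φ z.1 z.2) inferInstance

/-- The Borel σ-algebra of the unit ball. -/
instance (x₀ : X) : MeasurableSpace (LipLBall x₀ E) := borel _

instance (x₀ : X) : BorelSpace (LipLBall x₀ E) := ⟨rfl⟩

/-! ### The Lipschitz tensor product -/

/-- The space `Lip₀(X; G)` of Lipschitz maps `X → G` that vanish at the base point `x₀`. -/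
def Lip₀ (x₀ : X) (G : Type*) [NormedAddCommGroup G] [NormedSpace ℝ G] :
    Submodule ℝ (X → G) where
  carrier := {f | (∃ K, LipschitzWith K f) ∧ f x₀ = 0}
  zero_mem' := ⟨⟨0, LipschitzWith.const 0⟩, rfl⟩
  add_mem' := by
    rintro f g ⟨⟨K, hf⟩, hf0⟩ ⟨⟨L, hg⟩, hg0⟩
    exact ⟨⟨K + L, hf.add hg⟩, by simp [hf0, hg0]⟩
  smul_mem' := by
    rintro c f ⟨⟨K, hf⟩, hf0⟩
    exact ⟨⟨_, (lipschitzWith_smul c).comp hf⟩, by simp [hf0]⟩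

/-- The functional `δ_(x,y) ⊠ e : f ↦ ⟨f x - f y, e⟩` on `Lip₀(X; E*)`. -/
def lipDelta (x₀ : X) (x y : X) (e : E) : Module.Dual ℝ (Lip₀ x₀ (StrongDual ℝ E)) where
  toFun f := (f.1 x - f.1 y) e
  map_add' f g := by
    change (f.1 x + g.1 x) e - (f.1 y + g.1 y) e = (f.1 x e - f.1 y e) + (g.1 x e - g.1 y e)
    change (f.1 x e + g.1 x e) - (f.1 y e + g.1 y e) = (f.1 x e - f.1 y e) + (g.1 x e - g.1 y e)
    ring
  map_smul' c f := by
    change c * f.1 x e - c * f.1 y e = c * (f.1 x e - f.1 y e)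
    ring

/-- The Lipschitz tensor product `X ⊠ E`: the span of the functionals `δ_(x,y) ⊠ e`. -/
def LipTensor (x₀ : X) (E : Type*) [NormedAddCommGroup E] [NormedSpace ℝ E] : Type _ :=
  Submodule.span ℝ (Set.range fun z : X × X × E => lipDelta x₀ z.1 z.2.1 z.2.2)

instance (x₀ : X) : AddCommGroup (LipTensor x₀ E) :=
  inferInstanceAs (AddCommGroup (Submodule.span ℝ
    (Set.range fun z : X × X × E => lipDelta x₀ z.1 z.2.1 z.2.2)))

instance (x₀ : X) : Module ℝ (LipTensor x₀ E) :=
  inferInstanceAs (Module ℝ (Submodule.span ℝ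
    (Set.range fun z : X × X × E => lipDelta x₀ z.1 z.2.1 z.2.2)))

/-- `δ_(x,y) ⊠ e` as an element of `X ⊠ E`. -/
def LipTensor.mk (x₀ : X) (x y : X) (e : E) : LipTensor x₀ E :=
  ⟨lipDelta x₀ x y e, Submodule.subset_span ⟨(x, y, e), rfl⟩⟩

/-- `u = ∑ δ_(xᵢ,yᵢ) ⊠ eᵢ`. -/
def LipTensor.IsRep {x₀ : X} (u : LipTensor x₀ E) {n : ℕ} (x y : Fin n → X) (e : Fin n → E) :
    Prop :=
  u = ∑ i, LipTensor.mk x₀ (x i) (y i) (e i)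

/-- The Lipschitz projective norm
`π(u) = inf {∑ d(xᵢ,yᵢ) ‖eᵢ‖ : u = ∑ δ_(xᵢ,yᵢ) ⊠ eᵢ}`. -/
instance (x₀ : X) : Norm (LipTensor x₀ E) where
  norm u := sInf {r : ℝ | ∃ (n : ℕ) (x y : Fin n → X) (e : Fin n → E),
    u.IsRep x y e ∧ r = ∑ i, dist (x i) (y i) * ‖e i‖}

namespace LipTensor

variable {x₀ : X}

theorem mk_smul (c : ℝ) (x y : X) (e : E) : c • mk x₀ x y e = mk x₀ x y (c • e) := by
  apply Subtype.ext
  apply LinearMap.ext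
  intro f
  change c • ((f.1 x - f.1 y) e) = (f.1 x - f.1 y) (c • e)
  rw [map_smul]

theorem IsRep.add {u v : LipTensor x₀ E} {n m : ℕ} {x y : Fin n → X} {e : Fin n → E}
    {x' y' : Fin m → X} {e' : Fin m → E} (hu : u.IsRep x y e) (hv : v.IsRep x' y' e') :
    (u + v).IsRep (Fin.append x x') (Fin.append y y') (Fin.append e e') := by
  unfold IsRep at *
  rw [Fin.sum_univ_add]
  simp only [Fin.append_left, Fin.append_right]
  rw [← hu, ← hv]

theorem IsRep.smul {u : LipTensor x₀ E} {n : ℕ} {x y : Fin n → X} {e : Fin n → E}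
    (hu : u.IsRep x y e) (c : ℝ) : (c • u).IsRep x y (fun i => c • e i) := by
  unfold IsRep at *
  rw [hu, Finset.smul_sum]
  simp only [mk_smul]

theorem exists_rep (u : LipTensor x₀ E) :
    ∃ (n : ℕ) (x y : Fin n → X) (e : Fin n → E), u.IsRep x y e := by
  obtain ⟨u, hu⟩ := u
  induction hu using Submodule.span_induction with
  | mem z hz =>
    obtain ⟨⟨x, y, e⟩, rfl⟩ := hz
    refine ⟨1, fun _ => x, fun _ => y, fun _ => e, ?_⟩
    simp only [IsRep, Finset.univ_unique, Finset.sum_singleton]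
    rfl
  | zero =>
    refine ⟨0, Fin.elim0, Fin.elim0, Fin.elim0, ?_⟩
    simp only [IsRep, Finset.univ_eq_empty, Finset.sum_empty]
    rfl
  | add a b ha hb iha ihb =>
    obtain ⟨n, x, y, e, h⟩ := iha
    obtain ⟨m, x', y', e', h'⟩ := ihb
    exact ⟨_, _, _, _, h.add h'⟩
  | smul c a ha ih =>
    obtain ⟨n, x, y, e, h⟩ := ih
    exact ⟨_, _, _, _, h.smul c⟩

theorem norm_bddBelow (u : LipTensor x₀ E) :
    BddBelow {r : ℝ | ∃ (n : ℕ) (x y : Fin n → X) (e : Fin n → E),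
      u.IsRep x y e ∧ r = ∑ i, dist (x i) (y i) * ‖e i‖} := by
  refine ⟨0, ?_⟩
  rintro r ⟨n, x, y, e, -, rfl⟩
  positivity

theorem norm_le {u : LipTensor x₀ E} {n : ℕ} {x y : Fin n → X} {e : Fin n → E}
    (h : u.IsRep x y e) : ‖u‖ ≤ ∑ i, dist (x i) (y i) * ‖e i‖ :=
  csInf_le (norm_bddBelow u) ⟨n, x, y, e, h, rfl⟩

theorem le_norm {u : LipTensor x₀ E} {a : ℝ}
    (h : ∀ (n : ℕ) (x y : Fin n → X) (e : Fin n → E), u.IsRep x y e →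
      a ≤ ∑ i, dist (x i) (y i) * ‖e i‖) : a ≤ ‖u‖ := by
  obtain ⟨n, x, y, e, hr⟩ := exists_rep u
  refine le_csInf ⟨_, n, x, y, e, hr, rfl⟩ ?_
  rintro r ⟨n, x, y, e, hr, rfl⟩
  exact h n x y e hr

theorem IsRep.apply {u : LipTensor x₀ E} {n : ℕ} {x y : Fin n → X} {e : Fin n → E}
    (h : u.IsRep x y e) (f : Lip₀ x₀ (StrongDual ℝ E)) :
    u.1 f = ∑ i, (f.1 (x i) - f.1 (y i)) (e i) := by
  unfold IsRep at h
  have key : ∀ s : Finset (Fin n), (∑ i ∈ s, mk x₀ (x i) (y i) (e i) : LipTensor x₀ E).1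
      = ∑ i ∈ s, lipDelta x₀ (x i) (y i) (e i) := by
    intro s
    induction s using Finset.cons_induction with
    | empty => rfl
    | cons a s ha ih =>
      rw [Finset.sum_cons, Finset.sum_cons, ← ih]
      rfl
  rw [h, key, LinearMap.sum_apply]
  rfl

theorem apply_le (u : LipTensor x₀ E) (f : Lip₀ x₀ (StrongDual ℝ E)) {K : NNReal}
    (hf : LipschitzWith K f.1) : |u.1 f| ≤ K * ‖u‖ := by
  rcases eq_or_lt_of_le (zero_le (a := K)) with hK | hK
  · obtain ⟨n, x, y, e, h⟩ := exists_rep u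
    have h0 : ∀ i, f.1 (x i) - f.1 (y i) = 0 := fun i => by
      have := hf.dist_le_mul (x i) (y i)
      rw [← hK, NNReal.coe_zero, zero_mul, dist_eq_norm] at this
      exact norm_le_zero_iff.mp this
    rw [h.apply f, ← hK]
    simp [h0]
  · have hK' : (0 : ℝ) < K := hK
    rw [← div_le_iff₀' hK']
    refine le_norm fun n x y e h => ?_
    rw [div_le_iff₀' hK', h.apply f, Finset.mul_sum]
    refine (Finset.abs_sum_le_sum_abs _ _).trans (Finset.sum_le_sum fun i _ => ?_)
    rw [← Real.norm_eq_abs, ← mul_assoc]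
    refine ((f.1 (x i) - f.1 (y i)).le_opNorm (e i)).trans ?_
    gcongr
    rw [← dist_eq_norm]
    exact hf.dist_le_mul _ _

theorem norm_nonneg' (u : LipTensor x₀ E) : 0 ≤ ‖u‖ :=
  le_norm fun _ _ _ _ _ => by positivity

theorem norm_smul_le' (c : ℝ) (u : LipTensor x₀ E) : ‖c • u‖ ≤ |c| * ‖u‖ := by
  rcases eq_or_ne c 0 with rfl | hc
  · have h : IsRep (0 • u : LipTensor x₀ E) (n := 0) Fin.elim0 Fin.elim0 Fin.elim0 := by
      simp [IsRep]
    simpa using norm_le h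
  · have hc' : 0 < |c| := abs_pos.mpr hc
    rw [← div_le_iff₀' hc']
    refine le_norm fun n x y e h => ?_
    rw [div_le_iff₀' hc', Finset.mul_sum]
    refine (norm_le (h.smul c)).trans (le_of_eq (Finset.sum_congr rfl fun i _ => ?_))
    rw [norm_smul, Real.norm_eq_abs]
    ring

theorem normedSpaceCore (x₀ : X) : NormedSpace.Core ℝ (LipTensor x₀ E) where
  norm_nonneg := norm_nonneg'
  norm_smul c u := by
    refine le_antisymm (norm_smul_le' c u) ?_
    rcases eq_or_ne c 0 with rfl | hc
    · simpa using norm_nonneg' ((0 : ℝ) • u)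
    · have h := norm_smul_le' c⁻¹ (c • u)
      rw [smul_smul, inv_mul_cancel₀ hc, one_smul, abs_inv] at h
      rw [Real.norm_eq_abs]
      rwa [inv_mul_eq_div, le_div_iff₀' (abs_pos.mpr hc)] at h
  norm_triangle u v := by
    rw [← sub_le_iff_le_add]
    refine le_norm fun n x y e h => ?_
    rw [sub_le_comm]
    refine le_norm fun m x' y' e' h' => ?_
    rw [sub_le_iff_le_add']
    have := norm_le (h.add h')
    rw [Fin.sum_univ_add] at this
    simpa only [Fin.append_left, Fin.append_right] using this
  norm_eq_zero_iff u := by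
    constructor
    · intro h
      apply Subtype.ext
      apply LinearMap.ext
      intro f
      obtain ⟨⟨K, hK⟩, -⟩ := f.2
      have := apply_le u f hK
      rw [h, mul_zero] at this
      exact abs_nonpos_iff.mp this
    · rintro rfl
      simpa using le_antisymm (by simpa using norm_smul_le' 0 (0 : LipTensor x₀ E))
        (norm_nonneg' (0 : LipTensor x₀ E))

end LipTensor

instance (x₀ : X) : NormedAddCommGroup (LipTensor x₀ E) :=
  NormedAddCommGroup.ofCore (LipTensor.normedSpaceCore x₀)

instance (x₀ : X) : NormedSpace ℝ (LipTensor x₀ E) :=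
  NormedSpace.ofCore (LipTensor.normedSpaceCore x₀)

/-- The completion of `X ⊠ E` for the Lipschitz projective norm. -/
abbrev LipTensorCompletion (x₀ : X) (E : Type*) [NormedAddCommGroup E] [NormedSpace ℝ E] :
    Type _ :=
  UniformSpace.Completion (LipTensor x₀ E)

/-! ### Linearization -/

namespace LipTensor

variable {x₀ : X}

/-- The sum `∑ (T (xᵢ, eᵢ) - T (yᵢ, eᵢ))` depends only on `u = ∑ δ_(xᵢ,yᵢ) ⊠ eᵢ`. -/
theorem sum_eq_of_isRep (T : LipLinear X E F) {u : LipTensor x₀ E} {n m : ℕ}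
    {x y : Fin n → X} {e : Fin n → E} {x' y' : Fin m → X} {e' : Fin m → E}
    (h : u.IsRep x y e) (h' : u.IsRep x' y' e') :
    ∑ i, (T (x i) (e i) - T (y i) (e i)) = ∑ i, (T (x' i) (e' i) - T (y' i) (e' i)) := by
  rw [SeparatingDual.eq_iff_forall_dual_eq (R := ℝ)]
  intro g
  obtain ⟨C, hC, hT⟩ := T.2
  let f : X → StrongDual ℝ E := fun z => g.comp
    ((T z - T x₀).mkContinuous (C * dist z x₀) (fun e => hT z x₀ e))
  have hf : ∀ z w e, (f z - f w) e = g (T z e - T w e) := by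
    intro z w e
    change g (T z e - T x₀ e) - g (T w e - T x₀ e) = g (T z e - T w e)
    rw [← map_sub]
    congr 1
    abel
  have hlip : LipschitzWith (‖g‖₊ * C.toNNReal) f := by
    refine LipschitzWith.of_dist_le_mul fun z w => ?_
    rw [dist_eq_norm]
    refine ContinuousLinearMap.opNorm_le_bound _ (by positivity) fun e => ?_
    rw [hf]
    refine (g.le_opNorm _).trans ?_
    have := mul_le_mul_of_nonneg_left (hT z w e) (norm_nonneg g)
    rw [NNReal.coe_mul, coe_nnnorm, Real.coe_toNNReal C hC.le]
    refine this.trans (le_of_eq ?_)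
    ring
  have hf0 : f x₀ = 0 := by
    ext e
    change g (T x₀ e - T x₀ e) = 0
    rw [sub_self, map_zero]
  have h1 := h.apply ⟨f, ⟨_, hlip⟩, hf0⟩
  have h2 := h'.apply ⟨f, ⟨_, hlip⟩, hf0⟩
  simp only [hf] at h1 h2
  rw [map_sum, map_sum, ← h1, ← h2]

/-- The value `∑ (T (xᵢ, eᵢ) - T (yᵢ, eᵢ))` for a representation `u = ∑ δ_(xᵢ,yᵢ) ⊠ eᵢ`. -/
def eval (T : LipLinear X E F) (u : LipTensor x₀ E) : F :=
  ∑ i, (T ((exists_rep u).choose_spec.choose i)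
      ((exists_rep u).choose_spec.choose_spec.choose_spec.choose i)
    - T ((exists_rep u).choose_spec.choose_spec.choose i)
      ((exists_rep u).choose_spec.choose_spec.choose_spec.choose i))

theorem eval_eq (T : LipLinear X E F) {u : LipTensor x₀ E} {n : ℕ}
    {x y : Fin n → X} {e : Fin n → E} (h : u.IsRep x y e) :
    eval T u = ∑ i, (T (x i) (e i) - T (y i) (e i)) :=
  sum_eq_of_isRep T (exists_rep u).choose_spec.choose_spec.choose_spec.choose_spec h

theorem norm_eval_le (T : LipLinear X E F) {C : ℝ} (hC : 0 < C)
    (hT : ∀ x y e, ‖T x e - T y e‖ ≤ C * dist x y * ‖e‖) (u : LipTensor x₀ E) :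
    ‖eval T u‖ ≤ C * ‖u‖ := by
  rw [← div_le_iff₀' hC]
  refine le_norm fun n x y e h => ?_
  rw [div_le_iff₀' hC, eval_eq T h, Finset.mul_sum]
  refine (norm_sum_le _ _).trans (Finset.sum_le_sum fun i _ => ?_)
  rw [← mul_assoc]
  exact hT _ _ _

end LipTensor

/-- The bounded linear map `X ⊠ E → F` given by
`∑ δ_(xᵢ,yᵢ) ⊠ eᵢ ↦ ∑ (T (xᵢ, eᵢ) - T (yᵢ, eᵢ))`. -/
def preLinearization (x₀ : X) (T : LipLinear X E F) : LipTensor x₀ E →L[ℝ] F :=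
  LinearMap.mkContinuousOfExistsBound
    { toFun := LipTensor.eval T
      map_add' := by
        intro u v
        obtain ⟨n, x, y, e, h⟩ := LipTensor.exists_rep u
        obtain ⟨m, x', y', e', h'⟩ := LipTensor.exists_rep v
        rw [LipTensor.eval_eq T h, LipTensor.eval_eq T h', LipTensor.eval_eq T (h.add h'),
          Fin.sum_univ_add]
        simp only [Fin.append_left, Fin.append_right]
      map_smul' := by
        intro c u
        obtain ⟨n, x, y, e, h⟩ := LipTensor.exists_rep u
        rw [LipTensor.eval_eq T h, LipTensor.eval_eq T (h.smul c), Finset.smul_sum]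
        simp only [map_smul, smul_sub, RingHom.id_apply] }
    (by
      obtain ⟨C, hC, hT⟩ := T.2
      exact ⟨C, LipTensor.norm_eval_le T hC hT⟩)

/-- The linearization `T̂ : X ⊠̂ E → F` of a Lip-linear operator `T`. -/
def linearization [CompleteSpace F] (x₀ : X) (T : LipLinear X E F) :
    LipTensorCompletion x₀ E →L[ℝ] F :=
  (preLinearization x₀ T).extend (UniformSpace.Completion.toComplL (𝕜 := ℝ))

theorem linearization_coe [CompleteSpace F] (x₀ : X) (T : LipLinear X E F)
    {u : LipTensor x₀ E} {n : ℕ} {x y : Fin n → X} {e : Fin n → E} (h : u.IsRep x y e) :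
    linearization x₀ T (u : LipTensorCompletion x₀ E)
      = ∑ i, (T (x i) (e i) - T (y i) (e i)) := by
  rw [← LipTensor.eval_eq T h]
  exact ContinuousLinearMap.extend_eq (preLinearization x₀ T)
    (UniformSpace.Completion.denseRange_coe)
    (UniformSpace.Completion.isUniformInducing_coe _) u

/-! ### Summing operators -/

theorem lp_norm_add_le {F : Type*} [NormedAddCommGroup F] {p : ℝ} (hp : 1 ≤ p) {n : ℕ} (a b : Fin n → F) :
    (∑ i, ‖a i + b i‖ ^ p) ^ (1 / p)
      ≤ (∑ i, ‖a i‖ ^ p) ^ (1 / p) + (∑ i, ‖b i‖ ^ p) ^ (1 / p) := by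
  refine le_trans ?_ (Real.Lp_add_le_of_nonneg (s := Finset.univ) (f := fun i => ‖a i‖)
    (g := fun i => ‖b i‖) hp (fun i _ => norm_nonneg _) (fun i _ => norm_nonneg _))
  gcongr
  exact norm_add_le _ _

theorem lp_norm_smul {p : ℝ} (hp : 1 ≤ p) {n : ℕ} (c : ℝ) (a : Fin n → F) :
    (∑ i, ‖c • a i‖ ^ p) ^ (1 / p) = |c| * (∑ i, ‖a i‖ ^ p) ^ (1 / p) := by
  have hp0 : p ≠ 0 := by positivity
  have h : ∀ i, ‖c • a i‖ ^ p = |c| ^ p * ‖a i‖ ^ p := fun i => by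
    rw [norm_smul, Real.norm_eq_abs, Real.mul_rpow (abs_nonneg c) (norm_nonneg _)]
  simp only [h]
  rw [← Finset.mul_sum, Real.mul_rpow (by positivity) (by positivity),
    ← Real.rpow_mul (abs_nonneg c), mul_one_div_cancel hp0, Real.rpow_one]

/-- The weak `ℓ_p` norm `sup {(∑ |φ(xᵢ)|^p)^(1/p) : φ ∈ B_{G*}}` of `x₁, …, xₙ ∈ G`. -/
def weakLpNorm {G : Type*} [NormedAddCommGroup G] [NormedSpace ℝ G] (p : ℝ) {n : ℕ}
    (x : Fin n → G) : ℝ :=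
  ⨆ φ : Metric.closedBall (0 : StrongDual ℝ G) 1, (∑ i, |φ.1 (x i)| ^ p) ^ (1 / p)

theorem weakLpNorm_nonneg {G : Type*} [NormedAddCommGroup G] [NormedSpace ℝ G] (p : ℝ) {n : ℕ}
    (x : Fin n → G) : 0 ≤ weakLpNorm p x :=
  Real.iSup_nonneg fun _ => by positivity

/-- The inequality defining `p`-summing linear operators, with the constant `C`. -/
def SummingBound {G : Type*} [NormedAddCommGroup G] [NormedSpace ℝ G] (p C : ℝ)
    (u : G →L[ℝ] F) : Prop :=
  ∀ (n : ℕ) (x : Fin n → G), (∑ i, ‖u (x i)‖ ^ p) ^ (1 / p) ≤ C * weakLpNorm p x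

/-- Absolutely `p`-summing linear operators. -/
def IsSumming {G : Type*} [NormedAddCommGroup G] [NormedSpace ℝ G] (p : ℝ)
    (u : G →L[ℝ] F) : Prop :=
  ∃ C : ℝ, 0 < C ∧ SummingBound p C u

/-- The `p`-summing norm `π_p(u)`. -/
def summingNorm {G : Type*} [NormedAddCommGroup G] [NormedSpace ℝ G] (p : ℝ)
    (u : G →L[ℝ] F) : ℝ :=
  sInf {C : ℝ | 0 < C ∧ SummingBound p C u}

/-- The space `Π_p(G; F)` of `p`-summing operators. -/
def SummingOperators (G F : Type*) [NormedAddCommGroup G] [NormedSpace ℝ G]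
    [NormedAddCommGroup F] [NormedSpace ℝ F] (p : ℝ) (hp : 1 ≤ p) :
    Submodule ℝ (G →L[ℝ] F) where
  carrier := {u | IsSumming p u}
  zero_mem' := ⟨1, one_pos, fun n x => by
    have hp0 : p ≠ 0 := by positivity
    have hp1 : 1 / p ≠ 0 := by positivity
    simpa [Real.zero_rpow hp0, Real.zero_rpow (inv_ne_zero hp0)] using weakLpNorm_nonneg p x⟩
  add_mem' := by
    rintro u v ⟨C, hC, hu⟩ ⟨D, hD, hv⟩
    refine ⟨C + D, by positivity, fun n x => ?_⟩
    refine (lp_norm_add_le hp (fun i => u (x i)) (fun i => v (x i))).trans ?_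
    rw [add_mul]
    exact add_le_add (hu n x) (hv n x)
  smul_mem' := by
    rintro c u ⟨C, hC, hu⟩
    refine ⟨(|c| + 1) * C, by positivity, fun n x => ?_⟩
    refine (lp_norm_smul hp c (fun i => u (x i))).le.trans ?_
    have h := mul_le_mul_of_nonneg_left (hu n x) (abs_nonneg c)
    have h' := mul_nonneg hC.le (weakLpNorm_nonneg p x)
    nlinarith

/-- The supremum
`sup {(∑ᵢ |∑ⱼ (φ(xᵢⱼ, eᵢⱼ) - φ(yᵢⱼ, eᵢⱼ))|^p)^(1/p) : φ ∈ B_{LipL₀(X × E)}}`. -/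
def lipWeakLpNorm (x₀ : X) (p : ℝ) {n m : ℕ} (x y : Fin n → Fin m → X)
    (e : Fin n → Fin m → E) : ℝ :=
  ⨆ φ : LipLBall x₀ E,
    (∑ i, |∑ j, (φ (x i j) (e i j) - φ (y i j) (e i j))| ^ p) ^ (1 / p)

theorem lipWeakLpNorm_nonneg (x₀ : X) (p : ℝ) {n m : ℕ} (x y : Fin n → Fin m → X)
    (e : Fin n → Fin m → E) : 0 ≤ lipWeakLpNorm x₀ p x y e :=
  Real.iSup_nonneg fun _ => by positivity

/-- The inequality defining factorable strongly `p`-summing Lip-linear operators, with the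
constant `C`. -/
def FactorableSummingBound (x₀ : X) (p C : ℝ) (T : LipLinear X E F) : Prop :=
  ∀ (n m : ℕ) (x y : Fin n → Fin m → X) (e : Fin n → Fin m → E),
    (∑ i, ‖∑ j, (T (x i j) (e i j) - T (y i j) (e i j))‖ ^ p) ^ (1 / p)
      ≤ C * lipWeakLpNorm x₀ p x y e

/-- Factorable strongly `p`-summing Lip-linear operators. -/
def IsFactorableSumming (x₀ : X) (p : ℝ) (T : LipLinear X E F) : Prop :=
  ∃ C : ℝ, 0 < C ∧ FactorableSummingBound x₀ p C T

/-- The norm `π_{F,St,p}^{LipL}(T)`. -/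
def factorableSummingNorm (x₀ : X) (p : ℝ) (T : LipLinear X E F) : ℝ :=
  sInf {C : ℝ | 0 < C ∧ FactorableSummingBound x₀ p C T}

/-- The space `Π_{F,St,p}^{LipL}(X × E; F)` of factorable strongly `p`-summing operators in
`LipL₀(X × E; F)`. -/
def FactorableSummingOperators (x₀ : X) (E F : Type*) [NormedAddCommGroup E] [NormedSpace ℝ E]
    [NormedAddCommGroup F] [NormedSpace ℝ F] (p : ℝ) (hp : 1 ≤ p) :
    Submodule ℝ (LipLinear₀ x₀ E F) where
  carrier := {T | IsFactorableSumming x₀ p (T : LipLinear X E F)}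
  zero_mem' := ⟨1, one_pos, fun n m x y e => by
    have hp0 : p ≠ 0 := by positivity
    have h : ∀ i, ∑ j, (((0 : LipLinear₀ x₀ E F) : LipLinear X E F) (x i j) (e i j)
        - ((0 : LipLinear₀ x₀ E F) : LipLinear X E F) (y i j) (e i j)) = 0 := fun i =>
      Finset.sum_eq_zero fun j _ => sub_self (0 : F)
    simpa [h, Real.zero_rpow hp0, Real.zero_rpow (inv_ne_zero hp0)] using
      lipWeakLpNorm_nonneg x₀ p x y e⟩
  add_mem' := by
    rintro S T ⟨C, hC, hS⟩ ⟨D, hD, hT⟩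
    refine ⟨C + D, by positivity, fun n m x y e => ?_⟩
    have h : ∀ i, ∑ j, (((S + T : LipLinear₀ x₀ E F) : LipLinear X E F) (x i j) (e i j)
        - ((S + T : LipLinear₀ x₀ E F) : LipLinear X E F) (y i j) (e i j))
        = ∑ j, (S.1 (x i j) (e i j) - S.1 (y i j) (e i j))
          + ∑ j, (T.1 (x i j) (e i j) - T.1 (y i j) (e i j)) := fun i => by
      rw [← Finset.sum_add_distrib]
      refine Finset.sum_congr rfl fun j _ => ?_
      change S.1 (x i j) (e i j) + T.1 (x i j) (e i j)
        - (S.1 (y i j) (e i j) + T.1 (y i j) (e i j)) = _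
      abel
    simp only [h]
    refine (lp_norm_add_le hp _ _).trans ?_
    rw [add_mul]
    exact add_le_add (hS n m x y e) (hT n m x y e)
  smul_mem' := by
    rintro c T ⟨C, hC, hT⟩
    refine ⟨(|c| + 1) * C, by positivity, fun n m x y e => ?_⟩
    have h : ∀ i, ∑ j, (((c • T : LipLinear₀ x₀ E F) : LipLinear X E F) (x i j) (e i j)
        - ((c • T : LipLinear₀ x₀ E F) : LipLinear X E F) (y i j) (e i j))
        = c • ∑ j, (T.1 (x i j) (e i j) - T.1 (y i j) (e i j)) := fun i => by
      rw [Finset.smul_sum]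
      refine Finset.sum_congr rfl fun j _ => ?_
      rw [smul_sub]
      rfl
    simp only [h]
    rw [lp_norm_smul hp]
    have h1 := mul_le_mul_of_nonneg_left (hT n m x y e) (abs_nonneg c)
    have h2 := mul_nonneg hC.le (lipWeakLpNorm_nonneg x₀ p x y e)
    nlinarith

end

end

noncomputable section

/-! ### Probability measures dominating convex families of continuous functions -/

section Domination

variable {K : Type*} [TopologicalSpace K] [CompactSpace K] [T2Space K] [MeasurableSpace K]
  [BorelSpace K]

/-! Every sum of differences of `T` in the statement is the value of the linearization at a finite
tensor `∑ δ_(x,y) ⊠ e`, and every element of the uncompleted tensor product is such a sum. Taking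
real-valued `φ`, linearization identifies `B_{LipL₀(X × E)}` with the unit ball of the dual of the
completed tensor product (`lipLBallEquiv`). Hence both suprema are the same number
(`lipWeakLpNorm_eq`), and factorable strong summability of `T` is the summing inequality of the
linearization restricted to families of finite tensors.

These tensors are dense and both sides of the inequality are continuous, so it extends to the
completion with the same constant (`factorableSummingBound_iff`). This gives 1 ⇔ 2 and equality of
the norms. The bijection is the universal property: `u ↦ ((x, e) ↦ u (δ_(x,x₀) ⊠ e))` inverts
linearization on maps vanishing at the base point. The equivalences do not need this vanishing,
since only differences of `T` occur.

For 2 ⇒ 3, Pietsch's argument applies on the ball, which is compact by Banach–Alaoglu. Hahn–Banach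
separates the strictly positive functions from the convex hull of the functions `‖T̂ u‖^p - C^p
|φ(u)|^p`, and Riesz representation turns the separating functional into a probability measure. For
3 ⇒ 2, the domination inequality is raised to the power `p`, summed and integrated. -/

open CompactlySupported in
/-- A positive normalised functional on `C(K, ℝ)` is given by a regular probability measure. -/
theorem exists_regular_probabilityMeasure_of_positive (Λ : C(K, ℝ) →ₗ[ℝ] ℝ)
    (hΛ : ∀ f, 0 ≤ f → 0 ≤ Λ f) (hΛ1 : Λ 1 = 1) :
    ∃ μ : Measure K, IsProbabilityMeasure μ ∧ μ.Regular ∧ ∀ f : C(K, ℝ), ∫ x, f x ∂μ = Λ f := by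
  let Λ' : C_c(K, ℝ) →ₚ[ℝ] ℝ := PositiveLinearMap.mk₀
    { toFun := fun f => Λ f.toContinuousMap
      map_add' := fun f g => Λ.map_add f.toContinuousMap g.toContinuousMap
      map_smul' := fun c f => Λ.map_smul c f.toContinuousMap }
    (fun f hf => hΛ _ hf)
  have hint : ∀ f : C(K, ℝ), ∫ x, f x ∂(RealRMK.rieszMeasure Λ') = Λ f := fun f =>
    RealRMK.integral_rieszMeasure Λ' (CompactlySupportedContinuousMap.continuousMapEquiv f)
  refine ⟨RealRMK.rieszMeasure Λ', ?_, inferInstance, hint⟩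
  -- Testing against the constant 1 gives total mass 1; as a `toReal` value this also excludes
  -- infinite mass.
  have h1 := hint 1
  rw [hΛ1] at h1
  simp only [ContinuousMap.one_apply, integral_const, smul_eq_mul, mul_one] at h1
  exact ⟨by rwa [measureReal_def, ENNReal.toReal_eq_one_iff] at h1⟩

/-- If every member of a nonempty convex family of continuous functions on a compact space takes a
nonpositive value, then some regular probability measure integrates all of them to nonpositive
numbers. -/
theorem exists_probabilityMeasure_integral_nonpos {S : Set C(K, ℝ)} (hS : Convex ℝ S)
    (hne : S.Nonempty) (h : ∀ f ∈ S, ∃ x, f x ≤ 0) :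
    ∃ μ : Measure K, IsProbabilityMeasure μ ∧ μ.Regular ∧ ∀ f ∈ S, ∫ x, f x ∂μ ≤ 0 := by
  let P : Set C(K, ℝ) := {f | ∀ x, 0 < f x}
  have hPopen : IsOpen P := by
    have := ContinuousMap.isOpen_setOfPred_mapsTo (X := K) (Y := ℝ) isCompact_univ
      (isOpen_Ioi (a := (0 : ℝ)))
    simpa [P, Set.MapsTo] using this
  have hPconv : Convex ℝ P := by
    intro f hf g hg a b ha hb hab x
    have := convex_Ioi (0 : ℝ) (hf x) (hg x) ha hb hab
    simpa using this
  have hdisj : Disjoint P S := by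
    rw [Set.disjoint_left]
    intro f hf hfS
    obtain ⟨x, hx⟩ := h f hfS
    exact absurd (hf x) (not_lt.mpr hx)
  obtain ⟨L, s, hL, hLS⟩ := geometric_hahn_banach_open hPconv hPopen hS hdisj
  -- `P` is a cone, so the bound `s` holds along whole rays. This forces `0 ≤ s` and `L ≤ 0` on `P`.
  have hPsmul : ∀ f ∈ P, ∀ t : ℝ, 0 < t → t * L f < s := fun f hf t ht => by
    have := hL (t • f) fun x => by simpa using mul_pos ht (hf x)
    simpa using this
  have h1P : (1 : C(K, ℝ)) ∈ P := fun x => by simp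
  have hs : 0 ≤ s := by
    by_contra! hs
    have h1 : L 1 < s := hL 1 h1P
    have h2 : s / L 1 * L 1 < s := hPsmul 1 h1P _ (div_pos_of_neg_of_neg hs (h1.trans hs))
    rw [div_mul_cancel₀ _ (h1.trans hs).ne] at h2
    exact lt_irrefl _ h2
  have hLP : ∀ f ∈ P, L f ≤ 0 := by
    intro f hf
    by_contra! hpos
    have h2 := hPsmul f hf ((s + 1) / L f) (by positivity)
    rw [div_mul_cancel₀ _ hpos.ne'] at h2
    linarith
  have hLnonneg : ∀ f : C(K, ℝ), 0 ≤ f → L f ≤ 0 := by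
    intro f hf
    have key : ∀ ε : ℝ, 0 < ε → L f + ε * L 1 ≤ 0 := fun ε hε => by
      have := hLP (f + ε • 1) fun x => by
        have : 0 ≤ f x := hf x
        simp only [ContinuousMap.add_apply, ContinuousMap.smul_apply, ContinuousMap.one_apply,
          smul_eq_mul, mul_one]
        linarith
      simpa using this
    -- This `ε` makes `ε * |L 1|` at most half of `L f`, which contradicts `key`.
    by_contra! hpos
    have h1 := hLP 1 h1P
    have h2 := key (L f / (2 * (|L 1| + 1))) (by positivity)
    have h3 : L f / (2 * (|L 1| + 1)) * |L 1| ≤ L f / 2 := by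
      rw [div_mul_eq_mul_div, div_le_div_iff₀ (by positivity) (by positivity)]
      nlinarith [abs_nonneg (L 1)]
    rw [abs_of_nonpos h1] at h2 h3
    linarith
  -- If `L 1 = 0`, then `‖f‖ • 1 - f ≥ 0` forces `L = 0`, which cannot separate `1 ∈ P` strictly
  -- from a point of `S`.
  have hL1 : L 1 < 0 := by
    refine lt_of_le_of_ne (hLP 1 h1P) fun h0 => ?_
    have hz : ∀ f, 0 ≤ L f := fun f => by
      have := hLnonneg (‖f‖ • 1 - f) fun x => by
        have := (le_abs_self _).trans (f.norm_coe_le_norm x)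
        simpa using this
      rw [map_sub, map_smul, h0, smul_zero, zero_sub] at this
      linarith
    have hz' : ∀ f, L f = 0 := fun f => le_antisymm (by simpa using hz (-f)) (hz f)
    obtain ⟨f, hf⟩ := hne
    have h2 := hL 1 h1P
    have h3 := hLS f hf
    rw [hz'] at h2 h3
    linarith
  -- Dividing by the negative number `L 1` makes the functional positive and normalised, and
  -- reverses `0 ≤ s ≤ L f` on `S`.
  obtain ⟨μ, hμ, hreg, hint⟩ := exists_regular_probabilityMeasure_of_positive
    ((L 1)⁻¹ • (L : C(K, ℝ) →ₗ[ℝ] ℝ))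
    (fun f hf => by
      have := mul_nonneg_of_nonpos_of_nonpos (inv_nonpos.mpr hL1.le) (hLnonneg f hf)
      simpa using this)
    (by simp [hL1.ne])
  refine ⟨μ, hμ, hreg, fun f hf => ?_⟩
  rw [hint]
  have := mul_nonpos_of_nonpos_of_nonneg (inv_nonpos.mpr hL1.le) (hs.trans (hLS f hf))
  simpa using this

/-- The abstract Pietsch domination theorem: if `∑ a (u i) ≤ sup ∑ b (u i)` for all finite
families, and the pair `(a, b)` may be rescaled by nonnegative factors, then `a` is dominated by
the average of `b` with respect to a regular probability measure. -/
theorem exists_probabilityMeasure_le_integral {U : Type*} [Nonempty U] (a : U → ℝ)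
    (b : U → C(K, ℝ))
    (hscale : ∀ t : ℝ, 0 ≤ t → ∀ u, ∃ v, a v = t * a u ∧ b v = t • b u)
    (h : ∀ (n : ℕ) (u : Fin n → U), ∃ x, ∑ i, a (u i) ≤ ∑ i, b (u i) x) :
    ∃ μ : Measure K, IsProbabilityMeasure μ ∧ μ.Regular ∧ ∀ u, a u ≤ ∫ x, b u x ∂μ := by
  let f : U → C(K, ℝ) := fun u => a u • 1 - b u
  obtain ⟨μ, hμ, hreg, hint⟩ := exists_probabilityMeasure_integral_nonpos
    (convex_convexHull ℝ (Set.range f)) ((Set.range_nonempty f).mono (subset_convexHull ℝ _)) (by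
      intro g hg
      rw [convexHull_eq] at hg
      obtain ⟨ι, t, w, z, hw, hw1, hz, rfl⟩ := hg
      -- By `hscale` the weights are absorbed into the points, so a convex combination becomes a
      -- plain sum to which `h` applies.
      have hv : ∀ i : t, ∃ v, f v = w i • z i := fun i => by
        obtain ⟨u, hu⟩ := hz i i.2
        obtain ⟨v, hav, hbv⟩ := hscale (w i) (hw i i.2) u
        refine ⟨v, ?_⟩
        rw [← hu]
        simp only [f, hav, hbv, smul_sub, mul_smul]
      choose v hv using hv
      obtain ⟨x, hx⟩ := h t.card fun i => v (t.equivFin.symm i)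
      refine ⟨x, ?_⟩
      rw [t.equivFin.symm.sum_comp (fun i => a (v i)),
        t.equivFin.symm.sum_comp (fun i => b (v i) x)] at hx
      have hsum : t.centerMass w z x = ∑ i : t, f (v i) x := by
        rw [Finset.centerMass_eq_of_sum_1 _ _ hw1, ContinuousMap.sum_apply,
          ← Finset.sum_coe_sort]
        exact Finset.sum_congr rfl fun i _ => by rw [hv]
      rw [hsum]
      simp only [f, ContinuousMap.sub_apply, ContinuousMap.smul_apply, ContinuousMap.one_apply,
        smul_eq_mul, mul_one, Finset.sum_sub_distrib]
      linarith)
  refine ⟨μ, hμ, hreg, fun u => ?_⟩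
  have h1 := hint (f u) (subset_convexHull ℝ _ ⟨u, rfl⟩)
  have h2 : Integrable (b u) μ := (b u).continuous.integrable_of_hasCompactSupport
    (HasCompactSupport.of_compactSpace _)
  simp only [f, ContinuousMap.sub_apply, ContinuousMap.smul_apply, ContinuousMap.one_apply,
        smul_eq_mul, mul_one] at h1
  rw [integral_sub (integrable_const _) h2] at h1
  simp at h1
  linarith

end Domination

/-! ### Lip-linear operators and operators on the completed tensor product -/

section Correspondence

variable {X E F : Type*} [MetricSpace X] [NormedAddCommGroup E] [NormedSpace ℝ E]
  [NormedAddCommGroup F] [NormedSpace ℝ F] {x₀ : X}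

/-- For fixed `x, y, e` the inequality is a closed condition on the constant, so it survives passing
to the infimum. -/
theorem lipLNorm_bound (T : LipLinear X E F) (x y : X) (e : E) :
    ‖T x e - T y e‖ ≤ lipLNorm T * dist x y * ‖e‖ := by
  obtain ⟨C, hC, hT⟩ := T.2
  rw [mul_assoc]
  rcases (show 0 ≤ dist x y * ‖e‖ by positivity).eq_or_lt with h | h
  · have := hT x y e
    rw [mul_assoc] at this
    rwa [← h, mul_zero] at this ⊢
  · rw [← div_le_iff₀ h]
    refine le_csInf ⟨C, hC, hT⟩ ?_
    rintro D ⟨-, hD⟩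
    rw [div_le_iff₀ h, ← mul_assoc]
    exact hD x y e

theorem lipLNorm_le {T : LipLinear X E F} {C : ℝ} (hC : 0 < C)
    (h : ∀ x y e, ‖T x e - T y e‖ ≤ C * dist x y * ‖e‖) : lipLNorm T ≤ C :=
  csInf_le ⟨0, fun _ hD => hD.1.le⟩ ⟨hC, h⟩

/-! ### Elementary tensors and representations of common length -/

namespace LipTensor

theorem mk_add (x y : X) (e e' : E) : mk x₀ x y (e + e') = mk x₀ x y e + mk x₀ x y e' := by
  apply Subtype.ext
  apply LinearMap.ext
  intro f
  change (f.1 x - f.1 y) (e + e') = (f.1 x - f.1 y) e + (f.1 x - f.1 y) e'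
  rw [map_add]

theorem mk_sub_mk (x y z : X) (e : E) : mk x₀ x z e - mk x₀ y z e = mk x₀ x y e := by
  apply Subtype.ext
  apply LinearMap.ext
  intro f
  change (f.1 x e - f.1 z e) - (f.1 y e - f.1 z e) = f.1 x e - f.1 y e
  ring

theorem mk_self (x : X) (e : E) : mk x₀ x x e = 0 := by
  rw [← mk_sub_mk x x x, sub_self]

theorem isRep_mk (x y : X) (e : E) :
    (mk x₀ x y e).IsRep (fun _ : Fin 1 => x) (fun _ => y) (fun _ => e) := by
  simp [IsRep]

theorem norm_mk_le (x y : X) (e : E) : ‖mk x₀ x y e‖ ≤ dist x y * ‖e‖ := by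
  simpa using norm_le (isRep_mk (x₀ := x₀) x y e)

/-- A representation is padded with null terms `δ_(x₀,x₀) ⊠ 0`. -/
theorem IsRep.exists_of_le {u : LipTensor x₀ E} {n m : ℕ} {x y : Fin n → X} {e : Fin n → E}
    (h : u.IsRep x y e) (hnm : n ≤ m) :
    ∃ (x y : Fin m → X) (e : Fin m → E), u.IsRep x y e := by
  obtain ⟨k, rfl⟩ := Nat.exists_eq_add_of_le hnm
  have h0 : (0 : LipTensor x₀ E).IsRep (fun _ : Fin k => x₀) (fun _ => x₀) (fun _ => 0) := by
    simp [IsRep, mk_self]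
  exact ⟨_, _, _, by simpa using h.add h0⟩

/-- The definition of factorable summability uses one inner length `m` for all `i`; the sum of the
individual lengths serves as a common bound. -/
theorem exists_common_rep {n : ℕ} (u : Fin n → LipTensor x₀ E) :
    ∃ (m : ℕ) (x y : Fin n → Fin m → X) (e : Fin n → Fin m → E),
      ∀ i, (u i).IsRep (x i) (y i) (e i) := by
  choose k a b c h using fun i => exists_rep (u i)
  have hk : ∀ i, k i ≤ ∑ i, k i := fun i =>
    Finset.single_le_sum (fun _ _ => Nat.zero_le _) (Finset.mem_univ i)
  choose x y e h' using fun i => (h i).exists_of_le (hk i)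
  exact ⟨_, x, y, e, h'⟩

end LipTensor

/-! ### The universal property of the completed tensor product -/

theorem norm_linearization_apply_le [CompleteSpace F] (T : LipLinear X E F) {C : ℝ} (hC : 0 < C)
    (hT : ∀ x y e, ‖T x e - T y e‖ ≤ C * dist x y * ‖e‖) (u : LipTensorCompletion x₀ E) :
    ‖linearization x₀ T u‖ ≤ C * ‖u‖ := by
  induction u using UniformSpace.Completion.induction_on with
  | hp => exact isClosed_le (by fun_prop) (by fun_prop)
  | ih u =>
    obtain ⟨n, x, y, e, h⟩ := LipTensor.exists_rep u
    rw [linearization_coe x₀ T h, ← LipTensor.eval_eq T h, UniformSpace.Completion.norm_coe]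
    exact LipTensor.norm_eval_le T hC hT u

theorem linearization_mk [CompleteSpace F] (T : LipLinear X E F) (x y : X) (e : E) :
    linearization x₀ T (LipTensor.mk x₀ x y e : LipTensorCompletion x₀ E) = T x e - T y e := by
  simpa using linearization_coe x₀ T (LipTensor.isRep_mk x y e)

/-- Operators on the completed tensor product that agree on the elements `δ_(x,x₀) ⊠ e`
are equal. -/
theorem LipTensorCompletion.ext_mk {u v : LipTensorCompletion x₀ E →L[ℝ] F}
    (h : ∀ (x : X) (e : E), u (LipTensor.mk x₀ x x₀ e : LipTensorCompletion x₀ E)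
      = v (LipTensor.mk x₀ x x₀ e : LipTensorCompletion x₀ E)) : u = v := by
  ext w
  induction w using UniformSpace.Completion.induction_on with
  | hp => exact isClosed_eq (by fun_prop) (by fun_prop)
  | ih w =>
    obtain ⟨n, x, y, e, hw⟩ := LipTensor.exists_rep w
    -- Since `δ_(x,y) = δ_(x,x₀) - δ_(y,x₀)`, the values at the base-pointed tensors determine `g`
    -- on all finite tensors.
    have hc : ∀ g : LipTensorCompletion x₀ E →L[ℝ] F, g (w : LipTensorCompletion x₀ E)
        = ∑ i, (g (LipTensor.mk x₀ (x i) x₀ (e i) : LipTensorCompletion x₀ E)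
          - g (LipTensor.mk x₀ (y i) x₀ (e i) : LipTensorCompletion x₀ E)) := fun g => by
      have hg := map_sum (g.comp (UniformSpace.Completion.toComplL (𝕜 := ℝ)))
        (fun i => LipTensor.mk x₀ (x i) (y i) (e i)) Finset.univ
      rw [← hw] at hg
      refine hg.trans (Finset.sum_congr rfl fun i _ => ?_)
      rw [← LipTensor.mk_sub_mk (x i) (y i) x₀]
      exact map_sub (g.comp (UniformSpace.Completion.toComplL (𝕜 := ℝ))) _ _
    rw [hc u, hc v]
    simp only [h]

/-- The Lip-linear operator `(x, e) ↦ u (δ_(x,x₀) ⊠ e)` associated with a bounded operator `u`. -/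
def lipLinearOfOperator (u : LipTensorCompletion x₀ E →L[ℝ] F) : LipLinear X E F :=
  ⟨fun x => (u.comp (UniformSpace.Completion.toComplL (𝕜 := ℝ))).toLinearMap ∘ₗ
    { toFun := fun e => LipTensor.mk x₀ x x₀ e
      map_add' := LipTensor.mk_add x x₀
      map_smul' := fun c e => (LipTensor.mk_smul c x x₀ e).symm },
    ‖u‖ + 1, by positivity, fun x y e => by
      have h : u.comp (UniformSpace.Completion.toComplL (𝕜 := ℝ)) (LipTensor.mk x₀ x x₀ e)
          - u.comp (UniformSpace.Completion.toComplL (𝕜 := ℝ)) (LipTensor.mk x₀ y x₀ e)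
          = u (LipTensor.mk x₀ x y e : LipTensorCompletion x₀ E) := by
        rw [← map_sub, LipTensor.mk_sub_mk]
        rfl
      refine (congrArg norm h).le.trans ((u.le_opNorm _).trans ?_)
      rw [UniformSpace.Completion.norm_coe, mul_assoc]
      have := LipTensor.norm_mk_le (x₀ := x₀) x y e
      gcongr
      linarith⟩

theorem lipLinearOfOperator_apply (u : LipTensorCompletion x₀ E →L[ℝ] F) (x : X) (e : E) :
    lipLinearOfOperator u x e = u (LipTensor.mk x₀ x x₀ e : LipTensorCompletion x₀ E) := rfl

theorem lipLinearOfOperator_sub (u : LipTensorCompletion x₀ E →L[ℝ] F) (x y : X) (e : E) :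
    lipLinearOfOperator u x e - lipLinearOfOperator u y e
      = u (LipTensor.mk x₀ x y e : LipTensorCompletion x₀ E) := by
  rw [lipLinearOfOperator_apply, lipLinearOfOperator_apply, ← map_sub,
    ← UniformSpace.Completion.coe_sub, LipTensor.mk_sub_mk]

theorem lipLinearOfOperator_base (u : LipTensorCompletion x₀ E →L[ℝ] F) (e : E) :
    lipLinearOfOperator u x₀ e = 0 := by
  rw [lipLinearOfOperator_apply, LipTensor.mk_self, UniformSpace.Completion.coe_zero, map_zero]

theorem lipLNorm_lipLinearOfOperator_le (u : LipTensorCompletion x₀ E →L[ℝ] F) :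
    lipLNorm (lipLinearOfOperator u) ≤ ‖u‖ := by
  -- Admissible constants must be positive while `‖u‖` may vanish, so `‖u‖ + ε` is tested instead.
  refine le_of_forall_pos_le_add fun ε hε => lipLNorm_le (by positivity) fun x y e => ?_
  rw [lipLinearOfOperator_sub]
  refine (u.le_opNorm _).trans ?_
  rw [UniformSpace.Completion.norm_coe, mul_assoc]
  have := LipTensor.norm_mk_le (x₀ := x₀) x y e
  gcongr
  linarith

theorem linearization_lipLinearOfOperator [CompleteSpace F]
    (u : LipTensorCompletion x₀ E →L[ℝ] F) : linearization x₀ (lipLinearOfOperator u) = u :=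
  LipTensorCompletion.ext_mk fun x e => by
    rw [linearization_mk, lipLinearOfOperator_sub]

theorem lipLinearOfOperator_linearization [CompleteSpace F] (T : LipLinear X E F)
    (hT : ∀ e, T x₀ e = 0) : lipLinearOfOperator (linearization x₀ T) = T := by
  apply Subtype.ext
  funext x
  ext e
  exact (linearization_mk T x x₀ e).trans (by rw [hT, sub_zero])

theorem linearization_add [CompleteSpace F] (S T : LipLinear X E F) :
    linearization x₀ (S + T) = linearization x₀ S + linearization x₀ T :=
  LipTensorCompletion.ext_mk fun x e => by
    rw [add_apply, linearization_mk, linearization_mk, linearization_mk]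
    change S x e + T x e - (S x₀ e + T x₀ e) = _
    abel

theorem linearization_smul [CompleteSpace F] (c : ℝ) (T : LipLinear X E F) :
    linearization x₀ (c • T) = c • linearization x₀ T :=
  LipTensorCompletion.ext_mk fun x e => by
    rw [smul_apply, linearization_mk, linearization_mk]
    exact (smul_sub c (T x e) (T x₀ e)).symm

/-! ### The unit ball as a dual ball -/

/-- Linearization identifies the unit ball of `LipL₀(X × E)` with that of the dual of the completed
tensor product. -/
def lipLBallEquiv (x₀ : X) (E : Type*) [NormedAddCommGroup E] [NormedSpace ℝ E] :
    LipLBall x₀ E ≃ Metric.closedBall (0 : StrongDual ℝ (LipTensorCompletion x₀ E)) 1 where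
  toFun φ := ⟨linearization x₀ φ.1.1, by
    rw [mem_closedBall_zero_iff]
    refine ContinuousLinearMap.opNorm_le_bound _ zero_le_one fun u => ?_
    refine norm_linearization_apply_le _ one_pos (fun x y e => ?_) u
    refine (lipLNorm_bound φ.1.1 x y e).trans ?_
    have := φ.2
    gcongr⟩
  invFun g := ⟨⟨lipLinearOfOperator g.1, lipLinearOfOperator_base g.1⟩,
    (lipLNorm_lipLinearOfOperator_le g.1).trans (mem_closedBall_zero_iff.mp g.2)⟩
  left_inv φ := Subtype.ext (Subtype.ext (lipLinearOfOperator_linearization φ.1.1 φ.1.2))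
  right_inv g := Subtype.ext (linearization_lipLinearOfOperator g.1)

theorem LipLBall.continuous_apply (x : X) (e : E) :
    Continuous fun φ : LipLBall x₀ E => φ x e :=
  (_root_.continuous_apply (A := fun _ : X × E => ℝ) (x, e)).comp
    (continuous_induced_dom (f := fun (φ : LipLBall x₀ E) (z : X × E) => φ z.1 z.2))

instance : T2Space (LipLBall x₀ E) :=
  T2Space.of_injective_continuous
    (f := fun (φ : LipLBall x₀ E) (z : X × E) => φ z.1 z.2)
    (fun _ _ h => Subtype.ext (Subtype.ext (Subtype.ext (funext fun x =>
      LinearMap.ext fun e => congrFun h (x, e)))))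
    continuous_induced_dom

/-- The ball is a continuous image of the weak-* compact dual ball: evaluation at `(x, e)`
corresponds to evaluation of the functional at `δ_(x,x₀) ⊠ e`. -/
instance : CompactSpace (LipLBall x₀ E) := by
  let B : Set (WeakDual ℝ (LipTensorCompletion x₀ E)) :=
    WeakDual.toStrongDual ⁻¹' Metric.closedBall 0 1
  have hB : CompactSpace B := isCompact_iff_compactSpace.mp (WeakDual.isCompact_closedBall _ _)
  let f : B → LipLBall x₀ E := fun g => (lipLBallEquiv x₀ E).symm ⟨WeakDual.toStrongDual g.1, g.2⟩
  have hf : Continuous f := by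
    refine continuous_induced_rng.mpr (continuous_pi fun z => ?_)
    exact (WeakDual.eval_continuous
      (LipTensor.mk x₀ z.1 x₀ z.2 : LipTensorCompletion x₀ E)).comp continuous_subtype_val
  have hsurj : Function.Surjective f := fun φ =>
    ⟨⟨StrongDual.toWeakDual (lipLBallEquiv x₀ E φ).1, (lipLBallEquiv x₀ E φ).2⟩,
      (lipLBallEquiv x₀ E).symm_apply_apply φ⟩
  exact hsurj.compactSpace hf

instance : Nonempty (LipLBall x₀ E) :=
  (lipLBallEquiv x₀ E).nonempty_congr.mpr ⟨⟨0, by simp⟩⟩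

/-- Elements of the tensor product as continuous functions on the unit ball. -/
def LipTensor.toContinuousMap (u : LipTensor x₀ E) : C(LipLBall x₀ E, ℝ) where
  toFun φ := linearization x₀ φ.1.1 (u : LipTensorCompletion x₀ E)
  continuous_toFun := by
    obtain ⟨n, x, y, e, h⟩ := exists_rep u
    simp only [linearization_coe x₀ _ h]
    exact continuous_finsetSum _ fun i _ =>
      (LipLBall.continuous_apply _ _).sub (LipLBall.continuous_apply _ _)

theorem LipTensor.toContinuousMap_apply (u : LipTensor x₀ E) (φ : LipLBall x₀ E) :
    u.toContinuousMap φ = linearization x₀ φ.1.1 (u : LipTensorCompletion x₀ E) := rfl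

end Correspondence

/-! ### Weak `ℓ_p` norms -/

section Weak

theorem continuous_lp_norm {F : Type*} [NormedAddCommGroup F] {p : ℝ} (hp : 1 ≤ p) {n : ℕ} :
    Continuous fun x : Fin n → F => (∑ i, ‖x i‖ ^ p) ^ (1 / p) := by
  have hp0 : 0 ≤ p := by linarith
  refine Continuous.rpow_const ?_ fun _ => Or.inr (by positivity)
  refine continuous_finsetSum _ fun i _ => Continuous.rpow_const (by fun_prop) fun _ => Or.inr hp0

variable {G F : Type*} [NormedAddCommGroup G] [NormedSpace ℝ G] [NormedAddCommGroup F]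
  [NormedSpace ℝ F] {p : ℝ}

/-- Scaling a vector by `t^(1/p)` scales its `p`-th power by `t`; this is the rescaling needed in
Pietsch's argument. -/
theorem norm_smul_rpow_inv (hp : 1 ≤ p) {t : ℝ} (ht : 0 ≤ t) (z : F) :
    ‖t ^ p⁻¹ • z‖ ^ p = t * ‖z‖ ^ p := by
  have hp0 : p ≠ 0 := by positivity
  rw [norm_smul, Real.mul_rpow (norm_nonneg _) (norm_nonneg _), Real.norm_eq_abs,
    abs_of_nonneg (by positivity), Real.rpow_inv_rpow ht hp0]

theorem lp_apply_le_lp_norm (hp : 1 ≤ p) {n : ℕ} (x : Fin n → G)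
    (φ : Metric.closedBall (0 : StrongDual ℝ G) 1) :
    (∑ i, |φ.1 (x i)| ^ p) ^ (1 / p) ≤ (∑ i, ‖x i‖ ^ p) ^ (1 / p) := by
  have hφ := mem_closedBall_zero_iff.mp φ.2
  gcongr with i
  refine (φ.1.le_opNorm (x i)).trans ?_
  exact mul_le_of_le_one_left (norm_nonneg _) hφ

/-- The family must be shown bounded above, because a real `⨆` over an unbounded family is 0 by
convention. -/
theorem le_weakLpNorm (hp : 1 ≤ p) {n : ℕ} (x : Fin n → G)
    (φ : Metric.closedBall (0 : StrongDual ℝ G) 1) :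
    (∑ i, |φ.1 (x i)| ^ p) ^ (1 / p) ≤ weakLpNorm p x :=
  le_ciSup (f := fun φ : Metric.closedBall (0 : StrongDual ℝ G) 1 =>
    (∑ i, |φ.1 (x i)| ^ p) ^ (1 / p))
    ⟨_, Set.forall_mem_range.mpr (lp_apply_le_lp_norm hp x)⟩ φ

/-- Minkowski's inequality for each `φ`, with `x = y + (x - y)`; used in both directions, it bounds
the change of the weak norm by the `ℓ_p` distance and so yields continuity. -/
theorem weakLpNorm_le_add (hp : 1 ≤ p) {n : ℕ} (x y : Fin n → G) :
    weakLpNorm p x ≤ weakLpNorm p y + (∑ i, ‖x i - y i‖ ^ p) ^ (1 / p) := by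
  have : Nonempty (Metric.closedBall (0 : StrongDual ℝ G) 1) := ⟨⟨0, by simp⟩⟩
  refine ciSup_le fun φ => ?_
  have h := lp_norm_add_le hp (fun i => φ.1 (y i)) (fun i => φ.1 (x i - y i))
  simp only [← map_add, add_sub_cancel, Real.norm_eq_abs] at h
  exact h.trans (add_le_add (le_weakLpNorm hp y φ) (lp_apply_le_lp_norm hp (fun i => x i - y i) φ))

theorem continuous_weakLpNorm (hp : 1 ≤ p) {n : ℕ} :
    Continuous fun x : Fin n → G => weakLpNorm p x := by
  have hp0 : p ≠ 0 := by positivity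
  rw [continuous_iff_continuousAt]
  intro x
  refine tendsto_iff_dist_tendsto_zero.mpr (squeeze_zero (fun _ => dist_nonneg)
    (g := fun y => (∑ i, ‖y i - x i‖ ^ p) ^ (1 / p)) (fun y => ?_) ?_)
  · have h1 := weakLpNorm_le_add hp x y
    have h2 := weakLpNorm_le_add hp y x
    simp only [norm_sub_rev (x _) (y _)] at h1
    rw [Real.dist_eq, abs_sub_le_iff]
    constructor <;> linarith
  · have hc : Continuous fun y : Fin n → G => (∑ i, ‖y i - x i‖ ^ p) ^ (1 / p) :=
      (continuous_lp_norm hp).comp (f := fun (y : Fin n → G) i => y i - x i) (by fun_prop)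
    have := hc.tendsto x
    simpa [Real.zero_rpow hp0, Real.zero_rpow (inv_ne_zero hp0)] using this

/-- It suffices to check the `p`-summing inequality on a dense set. -/
theorem summingBound_of_denseRange (hp : 1 ≤ p) {C : ℝ} {u : G →L[ℝ] F} {D : Type*} {f : D → G}
    (hf : DenseRange f)
    (h : ∀ (n : ℕ) (d : Fin n → D),
      (∑ i, ‖u (f (d i))‖ ^ p) ^ (1 / p) ≤ C * weakLpNorm p fun i => f (d i)) :
    SummingBound p C u := fun n x => by
  have hd : DenseRange fun (d : Fin n → D) i => f (d i) := DenseRange.piMap fun _ => hf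
  refine hd.induction_on x (isClosed_le ?_ ((continuous_weakLpNorm hp).const_mul C)) (h n)
  exact (continuous_lp_norm hp).comp (f := fun (x : Fin n → G) i => u (x i)) (by fun_prop)

end Weak

/-! ### Summability of an operator and of its linearization -/

section Summing

variable {X E F : Type*} [MetricSpace X] [NormedAddCommGroup E] [NormedSpace ℝ E]
  [NormedAddCommGroup F] [NormedSpace ℝ F] [CompleteSpace F] {x₀ : X} {p : ℝ}

theorem weakLpNorm_coe {n : ℕ} (u : Fin n → LipTensor x₀ E) :
    weakLpNorm p (fun i => (u i : LipTensorCompletion x₀ E))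
      = ⨆ φ : LipLBall x₀ E, (∑ i, |(u i).toContinuousMap φ| ^ p) ^ (1 / p) :=
  ((lipLBallEquiv x₀ E).iSup_comp (g := fun
    φ : Metric.closedBall (0 : StrongDual ℝ (LipTensorCompletion x₀ E)) 1 =>
      (∑ i, |φ.1 (u i : LipTensorCompletion x₀ E)| ^ p) ^ (1 / p))).symm

theorem LipTensor.IsRep.toContinuousMap_apply {u : LipTensor x₀ E} {n : ℕ} {x y : Fin n → X}
    {e : Fin n → E} (h : u.IsRep x y e) (φ : LipLBall x₀ E) :
    u.toContinuousMap φ = ∑ i, (φ (x i) (e i) - φ (y i) (e i)) :=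
  linearization_coe x₀ φ.1.1 h

theorem lipWeakLpNorm_eq {n m : ℕ} {u : Fin n → LipTensor x₀ E} {x y : Fin n → Fin m → X}
    {e : Fin n → Fin m → E} (h : ∀ i, (u i).IsRep (x i) (y i) (e i)) :
    lipWeakLpNorm x₀ p x y e = weakLpNorm p (fun i => (u i : LipTensorCompletion x₀ E)) := by
  rw [weakLpNorm_coe, lipWeakLpNorm]
  simp only [(h _).toContinuousMap_apply]

/-- The constant is the same on both sides, so the sets of admissible constants coincide and the
norms agree. -/
theorem factorableSummingBound_iff (hp : 1 ≤ p) {C : ℝ} (T : LipLinear X E F) :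
    FactorableSummingBound x₀ p C T ↔ SummingBound p C (linearization x₀ T) := by
  constructor
  · intro h
    refine summingBound_of_denseRange hp UniformSpace.Completion.denseRange_coe fun n u => ?_
    obtain ⟨m, x, y, e, hu⟩ := LipTensor.exists_common_rep u
    rw [← lipWeakLpNorm_eq hu]
    simp only [linearization_coe x₀ T (hu _)]
    exact h n m x y e
  · intro h n m x y e
    have hu : ∀ i, (∑ j, LipTensor.mk x₀ (x i j) (y i j) (e i j)).IsRep (x i) (y i) (e i) :=
      fun _ => rfl
    rw [lipWeakLpNorm_eq hu]
    simp only [← linearization_coe x₀ T (hu _)]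
    exact h n _

theorem isFactorableSumming_iff (hp : 1 ≤ p) (T : LipLinear X E F) :
    IsFactorableSumming x₀ p T ↔ IsSumming p (linearization x₀ T) := by
  simp only [IsFactorableSumming, IsSumming, factorableSummingBound_iff hp]

theorem factorableSummingNorm_eq (hp : 1 ≤ p) (T : LipLinear X E F) :
    factorableSummingNorm x₀ p T = summingNorm p (linearization x₀ T) := by
  simp only [factorableSummingNorm, summingNorm, factorableSummingBound_iff hp]

/-! ### Pietsch domination and its converse -/

/-- The function `φ ↦ c |φ(u)|^p` on the unit ball. -/
def LipTensor.powContinuousMap (hp : 1 ≤ p) (c : ℝ) (u : LipTensor x₀ E) :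
    C(LipLBall x₀ E, ℝ) where
  toFun φ := c * |u.toContinuousMap φ| ^ p
  continuous_toFun := continuous_const.mul
    (u.toContinuousMap.continuous.abs.rpow_const fun _ => Or.inr (by linarith))

theorem LipTensor.powContinuousMap_apply (hp : 1 ≤ p) (c : ℝ) (u : LipTensor x₀ E)
    (φ : LipLBall x₀ E) : u.powContinuousMap hp c φ = c * |u.toContinuousMap φ| ^ p := rfl

/-- The Pietsch domination theorem for linearizations. -/
theorem SummingBound.exists_measure (hp : 1 ≤ p) {C : ℝ} (hC : 0 < C) {T : LipLinear X E F}
    (hT : SummingBound p C (linearization x₀ T)) :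
    ∃ μ : Measure (LipLBall x₀ E), IsProbabilityMeasure μ ∧ μ.Regular ∧ ∀ u : LipTensor x₀ E,
      ‖linearization x₀ T u‖ ≤ C * (∫ φ, |u.toContinuousMap φ| ^ p ∂μ) ^ (1 / p) := by
  have hp0 : 0 < p := by linarith
  obtain ⟨μ, hμ, hreg, h⟩ := exists_probabilityMeasure_le_integral
    (fun u : LipTensor x₀ E => ‖linearization x₀ T u‖ ^ p)
    (fun u : LipTensor x₀ E => u.powContinuousMap hp (C ^ p))
    (fun t ht u => ⟨t ^ p⁻¹ • u, by
      simp only [UniformSpace.Completion.coe_smul, map_smul]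
      exact norm_smul_rpow_inv hp ht _, by
      ext φ
      simp only [LipTensor.powContinuousMap_apply, LipTensor.toContinuousMap_apply,
        UniformSpace.Completion.coe_smul, map_smul, ← Real.norm_eq_abs,
        norm_smul_rpow_inv hp ht, ContinuousMap.smul_apply]
      exact mul_left_comm _ _ _⟩)
    (fun n u => by
      have hcont : Continuous fun φ : LipLBall x₀ E => ∑ i, |(u i).toContinuousMap φ| ^ p :=
        continuous_finsetSum _ fun i _ =>
          (u i).toContinuousMap.continuous.abs.rpow_const fun _ => Or.inr hp0.le
      -- The summing inequality involves a supremum, but the abstract theorem asks for a single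
      -- point; compactness supplies a maximiser.
      obtain ⟨φ, -, hφ⟩ := isCompact_univ.exists_isMaxOn Set.univ_nonempty hcont.continuousOn
      refine ⟨φ, ?_⟩
      have h1 : weakLpNorm p (fun i => (u i : LipTensorCompletion x₀ E))
          ≤ (∑ i, |(u i).toContinuousMap φ| ^ p) ^ (1 / p) := by
        rw [weakLpNorm_coe]
        refine ciSup_le fun ψ => ?_
        have := hφ (Set.mem_univ ψ)
        simp only [Set.mem_ofPred_eq] at this
        gcongr
      have h2 := (hT n fun i => (u i : LipTensorCompletion x₀ E)).trans
        (mul_le_mul_of_nonneg_left h1 hC.le)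
      have h3 := Real.rpow_le_rpow (by positivity) h2 hp0.le
      rw [Real.mul_rpow hC.le (by positivity), one_div, Real.rpow_inv_rpow (by positivity) hp0.ne',
        Real.rpow_inv_rpow (by positivity) hp0.ne'] at h3
      simpa only [LipTensor.powContinuousMap_apply, ← Finset.mul_sum] using h3)
  refine ⟨μ, hμ, hreg, fun u => ?_⟩
  have h1 := h u
  simp only [LipTensor.powContinuousMap_apply, integral_const_mul] at h1
  have hI : 0 ≤ ∫ φ, |u.toContinuousMap φ| ^ p ∂μ := integral_nonneg fun _ => by positivity
  rw [← Real.rpow_le_rpow_iff (norm_nonneg _) (by positivity) hp0,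
    Real.mul_rpow hC.le (by positivity), one_div, Real.rpow_inv_rpow hI hp0.ne']
  exact h1

/-- Integral domination implies the `p`-summing inequality. -/
theorem summingBound_of_measure (hp : 1 ≤ p) {C : ℝ} (hC : 0 < C) {T : LipLinear X E F}
    (μ : Measure (LipLBall x₀ E)) [IsProbabilityMeasure μ] (h : ∀ u : LipTensor x₀ E,
      ‖linearization x₀ T u‖ ≤ C * (∫ φ, |u.toContinuousMap φ| ^ p ∂μ) ^ (1 / p)) :
    SummingBound p C (linearization x₀ T) := by
  have hp0 : 0 < p := by linarith
  refine summingBound_of_denseRange hp UniformSpace.Completion.denseRange_coe fun n u => ?_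
  set W := weakLpNorm p fun i => (u i : LipTensorCompletion x₀ E)
  have hW : 0 ≤ W := weakLpNorm_nonneg _ _
  have hint : ∀ v : LipTensor x₀ E, Integrable (fun φ => |v.toContinuousMap φ| ^ p) μ := fun v =>
    (v.toContinuousMap.continuous.abs.rpow_const fun _ =>
      Or.inr hp0.le).integrable_of_hasCompactSupport (HasCompactSupport.of_compactSpace _)
  have hle : ∀ i, ‖linearization x₀ T (u i)‖ ^ p
      ≤ C ^ p * ∫ φ, |(u i).toContinuousMap φ| ^ p ∂μ := fun i => by
    have hI : 0 ≤ ∫ φ, |(u i).toContinuousMap φ| ^ p ∂μ := integral_nonneg fun _ => by positivity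
    have := Real.rpow_le_rpow (norm_nonneg _) (h (u i)) hp0.le
    rwa [Real.mul_rpow hC.le (by positivity), one_div, Real.rpow_inv_rpow hI hp0.ne'] at this
  -- Each `φ` is a functional in the dual ball, so this pointwise bound is uniform in `φ`;
  -- integrating it against a probability measure keeps `W ^ p`.
  have hpt : ∀ φ : LipLBall x₀ E, ∑ i, |(u i).toContinuousMap φ| ^ p ≤ W ^ p := fun φ => by
    have := Real.rpow_le_rpow (by positivity) (le_weakLpNorm hp
      (fun i => (u i : LipTensorCompletion x₀ E)) (lipLBallEquiv x₀ E φ)) hp0.le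
    rwa [one_div, Real.rpow_inv_rpow (by positivity) hp0.ne'] at this
  have hsum : ∑ i, ‖linearization x₀ T (u i)‖ ^ p ≤ (C * W) ^ p := by
    rw [Real.mul_rpow hC.le hW]
    refine (Finset.sum_le_sum fun i _ => hle i).trans ?_
    rw [← Finset.mul_sum, ← integral_finsetSum _ fun i _ => hint (u i)]
    refine mul_le_mul_of_nonneg_left ?_ (by positivity)
    refine (integral_mono (integrable_finsetSum _ fun i _ => hint (u i))
      (integrable_const (W ^ p)) hpt).trans ?_
    simp
  refine (Real.rpow_le_rpow (by positivity) hsum (by positivity)).trans ?_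
  rw [one_div, Real.rpow_rpow_inv (by positivity) hp0.ne']

/-- Domination on the tensor product amounts to domination on all finite sums. -/
theorem forall_norm_linearization_le_iff (C : ℝ) (T : LipLinear X E F)
    (μ : Measure (LipLBall x₀ E)) :
    (∀ u : LipTensor x₀ E,
      ‖linearization x₀ T u‖ ≤ C * (∫ φ, |u.toContinuousMap φ| ^ p ∂μ) ^ (1 / p)) ↔
    ∀ (m : ℕ) (x y : Fin m → X) (e : Fin m → E),
      ‖∑ j, (T (x j) (e j) - T (y j) (e j))‖
        ≤ C * (∫ φ : LipLBall x₀ E,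
            |∑ j, (φ (x j) (e j) - φ (y j) (e j))| ^ p ∂μ) ^ (1 / p) := by
  constructor
  · intro h m x y e
    have hu : (∑ j, LipTensor.mk x₀ (x j) (y j) (e j)).IsRep x y e := rfl
    have := h (∑ j, LipTensor.mk x₀ (x j) (y j) (e j))
    simpa only [linearization_coe x₀ T hu, hu.toContinuousMap_apply] using this
  · intro h u
    obtain ⟨m, x, y, e, hu⟩ := LipTensor.exists_rep u
    simpa only [linearization_coe x₀ T hu, hu.toContinuousMap_apply] using h m x y e

variable (x₀ E F) in
/-- The linear bijection `T ↦ T̂` between spaces of summing operators. -/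
def linearizationEquiv (hp : 1 ≤ p) : FactorableSummingOperators x₀ E F p hp ≃ₗ[ℝ]
    SummingOperators (LipTensorCompletion x₀ E) F p hp where
  toFun T := ⟨linearization x₀ T.1.1, (isFactorableSumming_iff hp T.1.1).mp T.2⟩
  map_add' S T := Subtype.ext (linearization_add S.1.1 T.1.1)
  map_smul' c T := Subtype.ext (linearization_smul c T.1.1)
  invFun u := ⟨⟨lipLinearOfOperator u.1, lipLinearOfOperator_base u.1⟩,
    (isFactorableSumming_iff hp _).mpr (by
      rw [linearization_lipLinearOfOperator]
      exact u.2)⟩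
  left_inv T := Subtype.ext (Subtype.ext (lipLinearOfOperator_linearization T.1.1 T.1.2))
  right_inv u := Subtype.ext (linearization_lipLinearOfOperator u.1)

end Summing

end

theorem mainTheorem2 {X E F : Type*} [MetricSpace X] (x₀ : X)
    [NormedAddCommGroup E] [NormedSpace ℝ E] [CompleteSpace E]
    [NormedAddCommGroup F] [NormedSpace ℝ F] [CompleteSpace F] (p : ℝ) (hp : 1 ≤ p) :
    (∀ T : LipLinear X E F, List.TFAE [
      IsFactorableSumming x₀ p T,
      IsSumming p (linearization x₀ T),
      ∃ μ : Measure (LipLBall x₀ E), IsProbabilityMeasure μ ∧ μ.Regular ∧ ∃ C : ℝ, 0 < C ∧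
        ∀ (m : ℕ) (x y : Fin m → X) (e : Fin m → E),
          ‖∑ j, (T (x j) (e j) - T (y j) (e j))‖
            ≤ C * (∫ φ : LipLBall x₀ E,
                |∑ j, (φ (x j) (e j) - φ (y j) (e j))| ^ p ∂μ) ^ (1 / p)]) ∧
    ∃ Φ : FactorableSummingOperators x₀ E F p hp ≃ₗ[ℝ]
        SummingOperators (LipTensorCompletion x₀ E) F p hp,
      (∀ T, (Φ T : LipTensorCompletion x₀ E →L[ℝ] F)
        = linearization x₀ ((T : LipLinear₀ x₀ E F) : LipLinear X E F)) ∧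
      ∀ T, summingNorm p (Φ T : LipTensorCompletion x₀ E →L[ℝ] F)
        = factorableSummingNorm x₀ p ((T : LipLinear₀ x₀ E F) : LipLinear X E F) := by
  refine ⟨fun T => ?_, linearizationEquiv E F x₀ hp, fun _ => rfl,
    fun T => (factorableSummingNorm_eq hp T.1.1).symm⟩
  tfae_have 1 ↔ 2 := isFactorableSumming_iff hp T
  tfae_have 2 → 3 := by
    rintro ⟨C, hC, hT⟩
    obtain ⟨μ, hμ, hreg, h⟩ := hT.exists_measure hp hC
    exact ⟨μ, hμ, hreg, C, hC, (forall_norm_linearization_le_iff C T μ).mp h⟩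
  tfae_have 3 → 2 := by
    rintro ⟨μ, hμ, -, C, hC, h⟩
    exact ⟨C, hC, summingBound_of_measure hp hC μ
      ((forall_norm_linearization_le_iff C T μ).mpr h)⟩
  tfae_finish
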